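/- Let $X$ be a real or complex Banach space, let $\mathcal L(X)$ be the Banach space of bounded linear operators on $X$, let $A,B\in\mathcal L(X)$, and let $L_AR_B\colon\mathcal L(X)\to\mathcal L(X)$ be the operator $T\mapsto ATB$. A bounded operator between normed spaces is called strictly singular if its restriction to any infinite-dimensional subspace of its domain is not an isomorphism onto its image (that is, is not bounded below), $c_0$-singular if its restriction to any subspace linearly homeomorphic to $c_0$ is not an isomorphism onto its image, and weakly compact if it maps the closed unit ball to a relatively weakly compact set. (a) If $L_AR_B$ is strictly singular, then $L_AR_B$ is $c_0$-singular. (b) Suppose that $X$ is reflexive and has an unconditional Schauder basis (countable, possibly finite). If $L_AR_B$ is $c_0$-singular, then $AB$ is a compact operator and $L_AR_B$ is weakly compact. In particular, if $L_AR_B$ is strictly singular, then it is weakly compact. -/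

import Mathlib

open scoped ZeroAtInfty

/-- `T` is an isomorphism (onto its image) when restricted to the subspace `M`, i.e. `T` is bounded
below on `M`. -/
def IsIsomorphismOn {𝕜 Y Z : Type*} [RCLike 𝕜] [NormedAddCommGroup Y] [NormedSpace 𝕜 Y]
    [NormedAddCommGroup Z] [NormedSpace 𝕜 Z] (T : Y →L[𝕜] Z) (M : Submodule 𝕜 Y) : Prop :=
  ∃ c : ℝ, 0 < c ∧ ∀ x ∈ M, c * ‖x‖ ≤ ‖T x‖

/-- Being bounded below on `M` is the same as the corestriction `M → T(M)` being a linear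
homeomorphism. -/
theorem isIsomorphismOn_iff {𝕜 Y Z : Type*} [RCLike 𝕜] [NormedAddCommGroup Y] [NormedSpace 𝕜 Y]
    [NormedAddCommGroup Z] [NormedSpace 𝕜 Z] (T : Y →L[𝕜] Z) (M : Submodule 𝕜 Y) :
    IsIsomorphismOn T M ↔
      ∃ e : M ≃L[𝕜] M.map (T : Y →ₗ[𝕜] Z), ∀ x : M, (e x : Z) = T x := by
  constructor
  · rintro ⟨c, hc, h⟩
    have inj : Function.Injective ((T : Y →ₗ[𝕜] Z).submoduleMap M) := by
      rw [injective_iff_map_eq_zero]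
      intro x hx
      have h1 : T x = 0 := congrArg Subtype.val hx
      have h2 := h x x.2
      rw [h1, norm_zero] at h2
      have h3 : ‖(x : Y)‖ = 0 :=
        le_antisymm (by by_contra! h4; nlinarith [mul_pos hc h4]) (norm_nonneg _)
      exact Subtype.ext (norm_eq_zero.mp h3)
    let e₀ := LinearEquiv.ofBijective ((T : Y →ₗ[𝕜] Z).submoduleMap M)
      ⟨inj, (T : Y →ₗ[𝕜] Z).submoduleMap_surjective M⟩
    refine ⟨e₀.toContinuousLinearEquivOfBounds ‖T‖ c⁻¹ (fun x => T.le_opNorm x) ?_, fun x => rfl⟩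
    intro y
    obtain ⟨x, rfl⟩ := e₀.surjective y
    rw [LinearEquiv.symm_apply_apply, inv_mul_eq_div, le_div_iff₀ hc, mul_comm]
    exact h x x.2
  · rintro ⟨e, he⟩
    refine ⟨(‖(e.symm : M.map (T : Y →ₗ[𝕜] Z) →L[𝕜] M)‖ + 1)⁻¹, by positivity, fun x hx => ?_⟩
    have h1 := (e.symm : M.map (T : Y →ₗ[𝕜] Z) →L[𝕜] M).le_opNorm (e ⟨x, hx⟩)
    have h2 : ‖e ⟨x, hx⟩‖ = ‖T x‖ := congrArg norm (he ⟨x, hx⟩)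
    have h3 : ‖(e.symm : M.map (T : Y →ₗ[𝕜] Z) →L[𝕜] M) (e ⟨x, hx⟩)‖ = ‖x‖ := by simp
    rw [h2, h3] at h1
    rw [inv_mul_le_iff₀ (by positivity)]
    nlinarith [norm_nonneg (T x)]

/-- `T` is strictly singular: it is not an isomorphism when restricted to any infinite-dimensional
subspace of its domain. -/
def IsStrictlySingular {𝕜 Y Z : Type*} [RCLike 𝕜] [NormedAddCommGroup Y] [NormedSpace 𝕜 Y]
    [NormedAddCommGroup Z] [NormedSpace 𝕜 Z] (T : Y →L[𝕜] Z) : Prop :=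
  ∀ M : Submodule 𝕜 Y, ¬ FiniteDimensional 𝕜 M → ¬ IsIsomorphismOn T M

/-- `T` is `E`-singular: it is not an isomorphism when restricted to any subspace of its domain
that is linearly isomorphic (i.e. linearly homeomorphic) to `E`. -/
def IsSpaceSingular {𝕜 Y Z : Type*} (E : Type*) [RCLike 𝕜] [NormedAddCommGroup E]
    [NormedSpace 𝕜 E] [NormedAddCommGroup Y] [NormedSpace 𝕜 Y]
    [NormedAddCommGroup Z] [NormedSpace 𝕜 Z] (T : Y →L[𝕜] Z) : Prop :=
  ∀ M : Submodule 𝕜 Y, Nonempty (E ≃L[𝕜] M) → ¬ IsIsomorphismOn T M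

/-- `T` is `c₀`-singular. Here `C₀(ℕ, 𝕜)` (functions on the discrete space `ℕ` vanishing at
infinity, with the sup norm) is the Banach space `c₀` of null sequences. -/
def IsCZeroSingular {𝕜 Y Z : Type*} [RCLike 𝕜] [NormedAddCommGroup Y] [NormedSpace 𝕜 Y]
    [NormedAddCommGroup Z] [NormedSpace 𝕜 Z] (T : Y →L[𝕜] Z) : Prop :=
  IsSpaceSingular C₀(ℕ, 𝕜) T

/-- `T` is weakly compact: the image of the closed unit ball is relatively compact in the weak
topology of the target. -/
def IsWeaklyCompactOperator {𝕜 Y Z : Type*} [RCLike 𝕜] [NormedAddCommGroup Y] [NormedSpace 𝕜 Y]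
    [NormedAddCommGroup Z] [NormedSpace 𝕜 Z] (T : Y →L[𝕜] Z) : Prop :=
  IsCompact (closure (toWeakSpace 𝕜 Z '' (T '' Metric.closedBall (0 : Y) 1)))

/-- `X` is reflexive: the canonical embedding of `X` into its bidual is onto. -/
def IsReflexiveSpace (𝕜 X : Type*) [RCLike 𝕜] [NormedAddCommGroup X] [NormedSpace 𝕜 X] : Prop :=
  Function.Surjective (NormedSpace.inclusionInDoubleDual 𝕜 X)

/-- `X` has a (countable, possibly finite) unconditional Schauder basis. -/
def HasUnconditionalBasis (𝕜 X : Type*) [RCLike 𝕜] [NormedAddCommGroup X] [NormedSpace 𝕜 X] :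
    Prop :=
  ∃ (β : Type) (_ : Countable β), Nonempty (UnconditionalSchauderBasis β 𝕜 X)

/-- The multiplication operator `L_A R_B : T ↦ A T B` on `𝓛(X)`, as a bounded operator. -/
noncomputable def multiplicationOperator {𝕜 X : Type*} [RCLike 𝕜] [NormedAddCommGroup X]
    [NormedSpace 𝕜 X] (A B : X →L[𝕜] X) : (X →L[𝕜] X) →L[𝕜] (X →L[𝕜] X) :=
  (ContinuousLinearMap.compL 𝕜 X X X A).comp ((ContinuousLinearMap.compL 𝕜 X X X).flip B)

theorem multiplicationOperator_apply {𝕜 X : Type*} [RCLike 𝕜] [NormedAddCommGroup X]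
    [NormedSpace 𝕜 X] (A B T : X →L[𝕜] X) :
    multiplicationOperator A B T = A.comp (T.comp B) := rfl

/-! Part (a) holds because `c₀` is infinite-dimensional. For (b), write `V = L_A R_B` and let `P_s`
be the basis projections. By unconditionality the blocks of `∑ (b_i* ⊗ b_i) T` have bounded finite
sums. If the image series under `V` were not norm-summable, disjoint blocks with large images would,
by Rosenthal's lemma, span a copy of `c₀` fixed by `V`. Hence `A P_s T B → ATB` in norm
(`hasSum_multiplicationOperator`), and `T = id` makes `AB` a norm limit of finite-rank operators.

For weak compactness, reflexivity makes the unit ball of `𝓛(X)` compact for pointwise weak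
convergence, and `V` is continuous from it to the weak topology: for each functional `φ`, `φ (V (T
P_s))` depends on finitely many vectors `T b_i` and approximates `φ (V T)` uniformly in `T`
(`exists_finset_norm_apply_sub_lt`). The uniformity comes from Pták's lemma applied to `|g (S x)|`
on the product of the weak ball of `X` and the weak-star ball of its dual. -/

/-- **Rosenthal's disjointification lemma** for nonnegative matrices with bounded row sums. -/
theorem exists_injective_offDiagonal_sum_le {ε : ℝ} (n : ℕ) (a : ℕ → ℕ → ℝ)
    (ha0 : ∀ k j, 0 ≤ a k j) (ha : ∀ k (s : Finset ℕ), ∑ j ∈ s, a k j ≤ n * ε) (hε : 0 < ε) :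
    ∃ f : ℕ → ℕ, Function.Injective f ∧
      ∀ k (s : Finset ℕ), k ∉ s → ∑ j ∈ s, a (f k) (f j) ≤ ε := by
  induction n generalizing a with
  | zero =>
    refine ⟨id, Function.injective_id, fun k s _ => ?_⟩
    have := ha k s
    simp only [Nat.cast_zero, zero_mul, id] at this ⊢
    linarith
  | succ n ih =>
    -- `Nat.pair p` enumerates the `p`-th of infinitely many disjoint infinite columns. If no column
    -- works, each has a bad row `g p`. The range of `g` meets column `p` only at `g p`, so
    -- restricting to that range removes more than `ε` from every row sum.
    by_cases h : ∃ p, ∀ q (s : Finset ℕ), q ∉ s →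
        ∑ j ∈ s, a (Nat.pair p q) (Nat.pair p j) ≤ ε
    · obtain ⟨p, hp⟩ := h
      exact ⟨Nat.pair p, fun x y hxy => (Nat.pair_eq_pair.mp hxy).2, hp⟩
    · push Not at h
      choose q s hqs hs using h
      set g : ℕ → ℕ := fun p => Nat.pair p (q p) with hg
      have hginj : Function.Injective g := fun x y hxy => (Nat.pair_eq_pair.mp hxy).1
      obtain ⟨f, hf, hfs⟩ := ih (fun p r => a (g p) (g r)) (fun _ _ => ha0 _ _) (by
        intro p R
        have hdisj : Disjoint (R.image g) ((s p).image (Nat.pair p)) := by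
          rw [Finset.disjoint_left]
          intro x hx hx'
          obtain ⟨r, -, rfl⟩ := Finset.mem_image.mp hx
          obtain ⟨j, hj, hjr⟩ := Finset.mem_image.mp hx'
          obtain ⟨rfl, rfl⟩ := Nat.pair_eq_pair.mp hjr
          exact hqs _ hj
        have h1 := ha (g p) (R.image g ∪ (s p).image (Nat.pair p))
        rw [Finset.sum_union hdisj, Finset.sum_image (fun x _ y _ h => hginj h),
          Finset.sum_image (fun x _ y _ h => (Nat.pair_eq_pair.mp h).2)] at h1
        have h2 := hs p
        push_cast at h1
        simp only [hg] at h1 ⊢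
        linarith)
      exact ⟨g ∘ f, hginj.comp hf, hfs⟩

theorem sum_abs_le_two_mul {ι : Type*} {M : ℝ} (a : ι → ℝ)
    (h : ∀ s : Finset ι, |∑ i ∈ s, a i| ≤ M) (s : Finset ι) : ∑ i ∈ s, |a i| ≤ 2 * M := by
  classical
  rw [← Finset.sum_filter_add_sum_filter_not s (fun i => 0 ≤ a i),
    Finset.sum_congr rfl (fun i hi => abs_of_nonneg (Finset.mem_filter.mp hi).2),
    Finset.sum_congr (s₁ := s.filter fun i => ¬ 0 ≤ a i) rfl
      (fun i hi => abs_of_neg (not_le.mp (Finset.mem_filter.mp hi).2)), Finset.sum_neg_distrib]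
  have h1 := (abs_le.mp (h (s.filter fun i => 0 ≤ a i))).2
  have h2 := (abs_le.mp (h (s.filter fun i => ¬ 0 ≤ a i))).1
  linarith

/-! ### Weakly unconditionally Cauchy series and copies of `c₀` -/

section

variable {𝕜 E F : Type*} [RCLike 𝕜] [NormedAddCommGroup E] [NormedSpace 𝕜 E]
  [NormedAddCommGroup F] [NormedSpace 𝕜 F]

/-- A series with bounded finite partial sums is weakly unconditionally Cauchy. -/
theorem sum_norm_apply_le_of_norm_sum_le {ι : Type*} {C : ℝ} {u : ι → E}
    (hu : ∀ s : Finset ι, ‖∑ i ∈ s, u i‖ ≤ C) (Φ : StrongDual 𝕜 E) (s : Finset ι) :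
    ∑ i ∈ s, ‖Φ (u i)‖ ≤ 4 * (C * ‖Φ‖) := by
  have hb : ∀ s : Finset ι, ‖∑ i ∈ s, Φ (u i)‖ ≤ C * ‖Φ‖ := fun s => by
    rw [← map_sum, mul_comm]
    exact (Φ.le_opNorm _).trans (by gcongr; exact hu s)
  -- The constant 4 is a factor 2 for splitting by sign, once for real and once for imaginary parts.
  have hre := sum_abs_le_two_mul (fun i => RCLike.re (Φ (u i))) (M := C * ‖Φ‖)
    (fun s => by
      rw [← map_sum]
      exact (RCLike.abs_re_le_norm _).trans (hb s)) s
  have him := sum_abs_le_two_mul (fun i => RCLike.im (Φ (u i))) (M := C * ‖Φ‖)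
    (fun s => by
      rw [← map_sum]
      exact (RCLike.abs_im_le_norm _).trans (hb s)) s
  calc ∑ i ∈ s, ‖Φ (u i)‖
      ≤ ∑ i ∈ s, (|RCLike.re (Φ (u i))| + |RCLike.im (Φ (u i))|) :=
        Finset.sum_le_sum fun i _ => by
          rw [← pow_le_pow_iff_left₀ (norm_nonneg _) (by positivity) two_ne_zero,
            RCLike.norm_sq_eq_def]
          nlinarith [sq_abs (RCLike.re (Φ (u i))), sq_abs (RCLike.im (Φ (u i))),
            mul_nonneg (abs_nonneg (RCLike.re (Φ (u i)))) (abs_nonneg (RCLike.im (Φ (u i))))]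
    _ ≤ 4 * (C * ‖Φ‖) := by rw [Finset.sum_add_distrib]; linarith

theorem norm_sum_smul_le {ι : Type*} {C r : ℝ} {u : ι → E}
    (hu : ∀ s : Finset ι, ‖∑ i ∈ s, u i‖ ≤ C) (c : ι → 𝕜) (s : Finset ι) (hr : 0 ≤ r)
    (hc : ∀ i ∈ s, ‖c i‖ ≤ r) : ‖∑ i ∈ s, c i • u i‖ ≤ 4 * C * r := by
  obtain ⟨Φ, hΦ, hΦx⟩ := exists_dual_vector'' 𝕜 (∑ i ∈ s, c i • u i)
  have hC : 0 ≤ C := by simpa using hu ∅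
  have h1 : ‖Φ (∑ i ∈ s, c i • u i)‖ = ‖∑ i ∈ s, c i • u i‖ := by
    rw [hΦx, RCLike.norm_ofReal, abs_norm]
  rw [← h1, map_sum]
  calc ‖∑ i ∈ s, Φ (c i • u i)‖ ≤ ∑ i ∈ s, r * ‖Φ (u i)‖ := by
        refine norm_sum_le_of_le _ fun i hi => ?_
        rw [map_smul, norm_smul]
        gcongr
        exact hc i hi
    _ = r * ∑ i ∈ s, ‖Φ (u i)‖ := by rw [Finset.mul_sum]
    _ ≤ r * (4 * (C * 1)) := by
        gcongr
        exact (sum_norm_apply_le_of_norm_sum_le hu Φ s).trans (by gcongr)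
    _ = 4 * C * r := by ring

theorem norm_apply_le_norm (l : C₀(ℕ, 𝕜)) (n : ℕ) : ‖l n‖ ≤ ‖l‖ := by
  rw [← ZeroAtInftyContinuousMap.norm_toBCF_eq_norm]
  exact l.toBCF.norm_coe_le_norm n

theorem norm_le_of_forall_norm_apply_le (l : C₀(ℕ, 𝕜)) {r : ℝ} (hr : 0 ≤ r)
    (h : ∀ n, ‖l n‖ ≤ r) : ‖l‖ ≤ r := by
  rw [← ZeroAtInftyContinuousMap.norm_toBCF_eq_norm]
  exact (BoundedContinuousFunction.norm_le hr).mpr h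

theorem summable_smul_of_norm_sum_le [CompleteSpace E] {C : ℝ} {u : ℕ → E}
    (hu : ∀ s : Finset ℕ, ‖∑ i ∈ s, u i‖ ≤ C) (l : C₀(ℕ, 𝕜)) :
    Summable fun n => l n • u n := by
  have hC : 0 ≤ C := by simpa using hu ∅
  rw [summable_iff_vanishing_norm]
  intro ε hε
  have hl : Filter.Tendsto l Filter.cofinite (nhds 0) := by
    rw [← Filter.cocompact_eq_cofinite]
    exact zero_at_infty l
  set r : ℝ := ε / (4 * C + 1) / 2
  have hr : 0 < r := by positivity
  have hfin : {n | ¬ ‖l n‖ < r}.Finite := by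
    have := hl.norm.eventually (gt_mem_nhds (by rwa [norm_zero] : ‖(0 : 𝕜)‖ < r))
    exact Filter.eventually_cofinite.mp this
  refine ⟨hfin.toFinset, fun t ht => ?_⟩
  refine (norm_sum_smul_le hu (fun n => l n) t hr.le fun i hi => ?_).trans_lt ?_
  · have := Finset.disjoint_left.mp ht hi
    rw [Set.Finite.mem_toFinset] at this
    exact (not_not.mp this).le
  · calc 4 * C * r < (4 * C + 1) * (2 * r) := by nlinarith
      _ = ε := by simp only [r]; field_simp

/-- The operator `c₀ → E` induced by a series with bounded finite partial sums. -/
theorem exists_clm_of_norm_sum_le [CompleteSpace E] {C : ℝ} {u : ℕ → E}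
    (hu : ∀ s : Finset ℕ, ‖∑ i ∈ s, u i‖ ≤ C) :
    ∃ J : C₀(ℕ, 𝕜) →L[𝕜] E, ∀ l, HasSum (fun n => l n • u n) (J l) := by
  have hs := summable_smul_of_norm_sum_le (𝕜 := 𝕜) hu
  let J₀ : C₀(ℕ, 𝕜) →ₗ[𝕜] E :=
    { toFun := fun l => ∑' n, l n • u n
      map_add' := fun l m => by
        rw [← (hs l).tsum_add (hs m)]
        simp [add_smul]
      map_smul' := fun c l => by
        rw [RingHom.id_apply, ← (hs l).tsum_const_smul c]
        simp [mul_smul] }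
  refine ⟨J₀.mkContinuous (4 * C) fun l => ?_, fun l => (hs l).hasSum⟩
  exact le_of_tendsto (hs l).hasSum.norm (Filter.Eventually.of_forall fun s =>
    norm_sum_smul_le hu _ s (norm_nonneg l) fun i _ => norm_apply_le_norm l i)

/-- A lower bound for `V ∘ J` passes to both factors: `J` embeds `G`, and `V` is bounded below on
the range of `J`. -/
theorem not_isSpaceSingular_of_comp_bounded_below {G : Type*} [NormedAddCommGroup G]
    [NormedSpace 𝕜 G] (V : E →L[𝕜] F) (J : G →L[𝕜] E) {c : ℝ} (hc : 0 < c)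
    (h : ∀ l, c * ‖l‖ ≤ ‖V (J l)‖) : ¬ IsSpaceSingular (𝕜 := 𝕜) G V := by
  intro hV
  have hJ : IsIsomorphismOn J ⊤ := by
    refine ⟨c / (‖V‖ + 1), by positivity, fun l _ => ?_⟩
    rw [div_mul_eq_mul_div, div_le_iff₀ (by positivity)]
    nlinarith [h l, V.le_opNorm (J l), norm_nonneg (J l)]
  obtain ⟨e, -⟩ := (isIsomorphismOn_iff J ⊤).mp hJ
  refine hV _ ⟨Submodule.topContEquiv.symm.trans e⟩ ?_
  refine ⟨c / (‖J‖ + 1), by positivity, ?_⟩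
  rintro _ ⟨l, -, rfl⟩
  rw [div_mul_eq_mul_div, div_le_iff₀ (by positivity)]
  have := h l
  have := J.le_opNorm l
  simp only [ContinuousLinearMap.coe_coe]
  have h3 : c * ‖J l‖ ≤ c * ((‖J‖ + 1) * ‖l‖) := by
    gcongr
    linarith [norm_nonneg l]
  nlinarith [norm_nonneg J]

/-- An operator that is seminormalized along a weakly unconditionally Cauchy series fixes a copy
of `c₀`. -/
theorem not_isCZeroSingular_of_norm_sum_le [CompleteSpace E] {C δ : ℝ} {u : ℕ → E}
    (hu : ∀ s : Finset ℕ, ‖∑ i ∈ s, u i‖ ≤ C) (V : E →L[𝕜] F) (hδ : 0 < δ)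
    (hV : ∀ n, δ ≤ ‖V (u n)‖) : ¬ IsCZeroSingular V := by
  choose Φ hΦ hΦu using fun n => exists_dual_vector'' 𝕜 (V (u n))
  have hC : 0 ≤ C := by simpa using hu ∅
  obtain ⟨N, hN⟩ := exists_nat_ge (4 * (C * ‖V‖) / (δ / 2))
  -- Diagonal entries are at least `δ`, so off-diagonal row sums of at most `δ / 2` leave half of
  -- the diagonal.
  obtain ⟨f, hf, hfs⟩ := exists_injective_offDiagonal_sum_le (ε := δ / 2) N
    (fun k j => ‖Φ k (V (u j))‖) (fun _ _ => norm_nonneg _) (fun k s => by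
      have := sum_norm_apply_le_of_norm_sum_le hu ((Φ k).comp V) s
      have h2 : ‖(Φ k).comp V‖ ≤ ‖V‖ :=
        ((Φ k).opNorm_comp_le V).trans (mul_le_of_le_one_left (norm_nonneg _) (hΦ k))
      rw [div_le_iff₀ (by positivity)] at hN
      refine this.trans (le_trans ?_ hN)
      gcongr) (by positivity)
  have huf : ∀ s : Finset ℕ, ‖∑ i ∈ s, (u ∘ f) i‖ ≤ C := fun s => by
    have := hu (s.map ⟨f, hf⟩)
    simpa using this
  obtain ⟨J, hJ⟩ := exists_clm_of_norm_sum_le (𝕜 := 𝕜) huf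
  refine not_isSpaceSingular_of_comp_bounded_below V J (half_pos hδ) fun l => ?_
  -- Testing against `Φ (f k)` isolates the coordinate `l k`; the supremum over `k` then gives the
  -- lower bound `δ / 2`.
  have key : ∀ k, δ * ‖l k‖ ≤ ‖V (J l)‖ + δ / 2 * ‖l‖ := by
    intro k
    have hsum := (((hJ l).mapL V).mapL (Φ (f k)))
    simp only [map_smul, Function.comp] at hsum
    have hdiff : ‖Φ (f k) (V (J l)) - l k • Φ (f k) (V (u (f k)))‖ ≤ δ / 2 * ‖l‖ := by
      refine le_of_tendsto (hsum.sub_const _).norm ?_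
      filter_upwards [Filter.eventually_ge_atTop {k}] with s hs
      rw [← Finset.add_sum_erase s _ (Finset.singleton_subset_iff.mp hs), add_sub_cancel_left]
      calc _ ≤ ∑ j ∈ s.erase k, ‖Φ (f k) (V (u (f j)))‖ * ‖l‖ := by
            refine norm_sum_le_of_le _ fun j _ => ?_
            rw [norm_smul, mul_comm]
            gcongr
            exact norm_apply_le_norm l j
        _ ≤ δ / 2 * ‖l‖ := by
            rw [← Finset.sum_mul]
            gcongr
            exact hfs k _ (Finset.notMem_erase k s)
    have h1 : ‖l k • Φ (f k) (V (u (f k)))‖ = ‖l k‖ * ‖V (u (f k))‖ := by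
      rw [norm_smul, hΦu, RCLike.norm_ofReal, abs_norm]
    have h2 : ‖Φ (f k) (V (J l))‖ ≤ ‖V (J l)‖ :=
      ((Φ (f k)).le_opNorm _).trans (mul_le_of_le_one_left (norm_nonneg _) (hΦ _))
    have h3 := norm_sub_norm_le (l k • Φ (f k) (V (u (f k)))) (Φ (f k) (V (J l)))
    rw [norm_sub_rev] at h3
    nlinarith [mul_le_mul_of_nonneg_left (hV (f k)) (norm_nonneg (l k))]
  have h4 : ‖l‖ ≤ (‖V (J l)‖ + δ / 2 * ‖l‖) / δ :=
    norm_le_of_forall_norm_apply_le l (by positivity) fun k => by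
      rw [le_div_iff₀ hδ, mul_comm]
      exact key k
  rw [le_div_iff₀ hδ] at h4
  linarith

/-- A non-summable family has a sequence of pairwise disjoint finite blocks with large sums. -/
theorem exists_disjoint_blocks_of_not_summable {ι : Type*} [CompleteSpace E] {u : ι → E}
    (hu : ¬ Summable u) : ∃ ε > 0, ∃ t : ℕ → Finset ι,
      Pairwise (Function.onFun Disjoint t) ∧ ∀ n, ε ≤ ‖∑ i ∈ t n, u i‖ := by
  classical
  rw [summable_iff_vanishing_norm] at hu
  push Not at hu
  obtain ⟨ε, hε, h⟩ := hu
  choose T hT hTε using h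
  -- `s n` collects all blocks chosen so far, and the next block `T (s n)` avoids it.
  let s : ℕ → Finset ι := fun n => Nat.rec ∅ (fun _ s => s ∪ T s) n
  have hs : ∀ n, s (n + 1) = s n ∪ T (s n) := fun n => rfl
  have hmono : Monotone s := monotone_nat_of_le_succ fun n => by
    rw [hs]; exact Finset.subset_union_left
  refine ⟨ε, hε, fun n => T (s n), ?_, fun n => hTε _⟩
  have hlt : ∀ m n, m < n → Disjoint (T (s m)) (T (s n)) := fun m n hmn =>
    ((hT (s n)).mono_right ((Finset.subset_union_right.trans (hs m).symm.subset).trans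
      (hmono hmn))).symm
  intro m n hmn
  rcases hmn.lt_or_gt with h | h
  · exact hlt m n h
  · exact (hlt n m h).symm

end

/-! ### Convex combinations of continuous functions -/

open scoped CompactlySupported in
/-- **Pták's lemma**: if nonnegative, uniformly bounded continuous functions on a compact space tend
to zero pointwise, then some convex combinations of them are uniformly small. -/
theorem exists_mem_convexHull_forall_lt {K : Type*} [TopologicalSpace K] [CompactSpace K]
    [T2Space K] {f : ℕ → C(K, ℝ)} {M : ℝ} (hf0 : ∀ n x, 0 ≤ f n x) (hfM : ∀ n x, f n x ≤ M)
    (hlim : ∀ x, Filter.Tendsto (fun n => f n x) Filter.atTop (nhds 0)) {ε : ℝ} (hε : 0 < ε) :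
    ∃ g ∈ convexHull ℝ (Set.range f), ∀ x, g x < ε := by
  by_contra! h
  let s : Set C(K, ℝ) := {g | ∀ x, g x < ε}
  have hs_open : IsOpen s := by
    have := ContinuousMap.isOpen_setOfPred_mapsTo (X := K) isCompact_univ (isOpen_Iio (a := ε))
    simpa [Set.MapsTo, s] using this
  have hs_conv : Convex ℝ s := by
    intro g hg g' hg' a b ha hb hab x
    exact (convex_Iio ε) (hg x) (hg' x) ha hb hab
  -- Since `s` contains every nonpositive function, the separating functional is positive, hence
  -- integration against a finite measure. Dominated convergence then contradicts `c ≤ Λ (f n)`.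
  obtain ⟨Λ, c, hΛs, hΛf⟩ := geometric_hahn_banach_open hs_conv hs_open
    (convex_convexHull ℝ (Set.range f)) (Set.disjoint_left.mpr fun g hg hg' => by
      obtain ⟨x, hx⟩ := h g hg'
      exact absurd (hg x) (not_lt.mpr hx))
  have hc : 0 < c := by simpa using hΛs 0 (fun x => by simpa using hε)
  have hpos : ∀ g : C(K, ℝ), (∀ x, 0 ≤ g x) → 0 ≤ Λ g := by
    intro g hg
    by_contra! hneg
    have h1 := hΛs ((c / Λ g) • g) (fun x => by
      have : c / Λ g ≤ 0 := div_nonpos_of_nonneg_of_nonpos hc.le hneg.le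
      exact (mul_nonpos_of_nonpos_of_nonneg this (hg x)).trans_lt hε)
    rw [map_smul, smul_eq_mul, div_mul_cancel₀ _ hneg.ne] at h1
    exact lt_irrefl _ h1
  let _ : MeasurableSpace K := borel K
  have _ : BorelSpace K := ⟨rfl⟩
  let L : C_c(K, ℝ) →ₚ[ℝ] ℝ := PositiveLinearMap.mk₀
    { toFun := fun g => Λ g.toContinuousMap
      map_add' := fun g g' => by
        rw [← map_add]; rfl
      map_smul' := fun a g => by
        rw [RingHom.id_apply, ← map_smul]; rfl }
    (fun g hg => hpos _ fun x => hg x)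
  let μ := RealRMK.rieszMeasure L
  have hint : ∀ n, ∫ x, f n x ∂μ = Λ (f n) := fun n =>
    RealRMK.integral_rieszMeasure L (CompactlySupportedContinuousMap.continuousMapEquiv (f n))
  have hfin : MeasureTheory.IsFiniteMeasure μ := inferInstance
  have htend : Filter.Tendsto (fun n => ∫ x, f n x ∂μ) Filter.atTop (nhds (∫ _, (0 : ℝ) ∂μ)) :=
    MeasureTheory.tendsto_integral_of_dominated_convergence (fun _ => M)
      (fun n => (f n).continuous.aestronglyMeasurable) (MeasureTheory.integrable_const M)
      (fun n => .of_forall fun x => by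
        rw [Real.norm_eq_abs, abs_of_nonneg (hf0 n x)]; exact hfM n x)
      (.of_forall hlim)
  rw [MeasureTheory.integral_zero] at htend
  have := ge_of_tendsto htend (.of_forall fun n => by
    rw [hint]; exact hΛf _ (subset_convexHull ℝ _ ⟨n, rfl⟩))
  linarith

/-! ### Weak topologies and pairings on the unit balls -/

section

variable {𝕜 X Y : Type*} [RCLike 𝕜] [NormedAddCommGroup X] [NormedSpace 𝕜 X]
  [NormedAddCommGroup Y] [NormedSpace 𝕜 Y]

theorem continuous_weakSpace_apply (g : StrongDual 𝕜 X) :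
    Continuous fun x : WeakSpace 𝕜 X => g ((toWeakSpace 𝕜 X).symm x) :=
  WeakBilin.eval_continuous (topDualPairing 𝕜 X).flip g

theorem continuous_to_weakSpace {α : Type*} [TopologicalSpace α] {f : α → WeakSpace 𝕜 X}
    (h : ∀ g : StrongDual 𝕜 X, Continuous fun a => g ((toWeakSpace 𝕜 X).symm (f a))) :
    Continuous f :=
  WeakBilin.continuous_of_continuous_eval (topDualPairing 𝕜 X).flip h

/-- By Hahn–Banach the ball is an intersection of weakly closed slabs. -/
theorem isClosed_closedBall_weakSpace (r : ℝ) :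
    IsClosed (toWeakSpace 𝕜 X '' Metric.closedBall (0 : X) r) := by
  have h : toWeakSpace 𝕜 X '' Metric.closedBall (0 : X) r =
      ⋂ g : Metric.closedBall (0 : StrongDual 𝕜 X) 1,
        {x | ‖g.1 ((toWeakSpace 𝕜 X).symm x)‖ ≤ r} := by
    ext x
    obtain ⟨x, rfl⟩ := (toWeakSpace 𝕜 X).surjective x
    rw [(toWeakSpace 𝕜 X).injective.mem_set_image, Set.mem_iInter, mem_closedBall_zero_iff]
    refine ⟨fun hx g => ?_, fun hx => ?_⟩
    · have hg : ‖g.1‖ ≤ 1 := mem_closedBall_zero_iff.mp g.2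
      exact ((g.1.le_opNorm x).trans (mul_le_of_le_one_left (norm_nonneg _) hg)).trans hx
    · obtain ⟨g, hg, hgx⟩ := exists_dual_vector'' 𝕜 x
      have h1 : ‖g x‖ ≤ r := hx ⟨g, mem_closedBall_zero_iff.mpr hg⟩
      rwa [hgx, RCLike.norm_ofReal, abs_norm] at h1
  rw [h]
  exact isClosed_iInter fun g =>
    isClosed_le (continuous_weakSpace_apply g.1).norm continuous_const

theorem isCompact_closedBall_weakSpace (hX : IsReflexiveSpace 𝕜 X) (r : ℝ) :
    IsCompact (toWeakSpace 𝕜 X '' Metric.closedBall (0 : X) r) := by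
  have h := NormedSpace.isCompact_closure_of_isBounded 𝕜 X
    (toWeakSpace 𝕜 X '' Metric.closedBall (0 : X) r)
    (by rw [Set.preimage_image_eq _ (toWeakSpace 𝕜 X).injective]; exact Metric.isBounded_closedBall)
    (fun g _ => by
      obtain ⟨x, hx⟩ := hX (WeakDual.toStrongDual g)
      exact ⟨toWeakSpace 𝕜 X x, congrArg StrongDual.toWeakDual hx⟩)
  rwa [(isClosed_closedBall_weakSpace r).closure_eq] at h

/-- The closed unit ball of `X` with the weak topology. -/
abbrev WeakUnitBall (𝕜 X : Type*) [RCLike 𝕜] [NormedAddCommGroup X] [NormedSpace 𝕜 X] :=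
  ↥(toWeakSpace 𝕜 X '' Metric.closedBall (0 : X) 1)

/-- The closed unit ball of the dual of `Y` with the weak-star topology. -/
abbrev WeakStarUnitBall (𝕜 Y : Type*) [RCLike 𝕜] [NormedAddCommGroup Y] [NormedSpace 𝕜 Y] :=
  ↥(WeakDual.toStrongDual ⁻¹' Metric.closedBall (0 : StrongDual 𝕜 Y) 1)

/-- The pairing `(x, g) ↦ g (S x)` on the product of the closed unit balls. -/
noncomputable def ballPairing (S : X →L[𝕜] Y) (p : WeakUnitBall 𝕜 X × WeakStarUnitBall 𝕜 Y) : 𝕜 :=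
  p.2.1 (S ((toWeakSpace 𝕜 X).symm p.1.1))

theorem norm_weakUnitBall_le (x : WeakUnitBall 𝕜 X) : ‖(toWeakSpace 𝕜 X).symm x.1‖ ≤ 1 := by
  obtain ⟨_, x, hx, rfl⟩ := x
  simpa using hx

theorem norm_apply_weakStarUnitBall_le (g : WeakStarUnitBall 𝕜 Y) (y : Y) : ‖g.1 y‖ ≤ ‖y‖ := by
  have h : ‖WeakDual.toStrongDual g.1‖ ≤ 1 := mem_closedBall_zero_iff.mp g.2
  exact ((WeakDual.toStrongDual g.1).le_opNorm y).trans
    (mul_le_of_le_one_left (norm_nonneg _) h)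

theorem norm_ballPairing_le (S : X →L[𝕜] Y) (p : WeakUnitBall 𝕜 X × WeakStarUnitBall 𝕜 Y) :
    ‖ballPairing S p‖ ≤ ‖S‖ :=
  (norm_apply_weakStarUnitBall_le _ _).trans ((S.le_opNorm _).trans
    (mul_le_of_le_one_right (norm_nonneg _) (norm_weakUnitBall_le _)))

theorem ballPairing_sub (S S' : X →L[𝕜] Y) (p : WeakUnitBall 𝕜 X × WeakStarUnitBall 𝕜 Y) :
    ballPairing (S - S') p = ballPairing S p - ballPairing S' p := by
  simp [ballPairing]

theorem ballPairing_add (S S' : X →L[𝕜] Y) (p : WeakUnitBall 𝕜 X × WeakStarUnitBall 𝕜 Y) :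
    ballPairing (S + S') p = ballPairing S p + ballPairing S' p := by
  simp [ballPairing]

theorem ballPairing_smul (a : 𝕜) (S : X →L[𝕜] Y)
    (p : WeakUnitBall 𝕜 X × WeakStarUnitBall 𝕜 Y) :
    ballPairing (a • S) p = a • ballPairing S p := by
  simp [ballPairing]

theorem opNorm_le_of_norm_ballPairing_le {S : X →L[𝕜] Y} {r : ℝ} (hr : 0 ≤ r)
    (h : ∀ p, ‖ballPairing S p‖ ≤ r) : ‖S‖ ≤ r := by
  refine ContinuousLinearMap.opNorm_le_of_unit_norm hr fun x hx => ?_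
  obtain ⟨g, hg, hgx⟩ := exists_dual_vector'' 𝕜 (S x)
  have h1 : ‖g (S x)‖ ≤ r := h ⟨⟨toWeakSpace 𝕜 X x, x, mem_closedBall_zero_iff.mpr hx.le, rfl⟩,
    ⟨StrongDual.toWeakDual g, mem_closedBall_zero_iff.mpr hg⟩⟩
  rwa [hgx, RCLike.norm_ofReal, abs_norm] at h1

/-- For rank one the pairing splits into a weakly continuous factor in `x` and a weak-star
continuous factor in the functional. -/
theorem continuous_ballPairing_smulRight (g : StrongDual 𝕜 X) (y : Y) :
    Continuous (ballPairing (g.smulRight y)) := by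
  have h1 : Continuous fun p : WeakUnitBall 𝕜 X × WeakStarUnitBall 𝕜 Y =>
      g ((toWeakSpace 𝕜 X).symm p.1.1) :=
    (continuous_weakSpace_apply g).comp (continuous_subtype_val.comp continuous_fst)
  have h2 : Continuous fun p : WeakUnitBall 𝕜 X × WeakStarUnitBall 𝕜 Y => p.2.1 y :=
    (WeakDual.eval_continuous y).comp (continuous_subtype_val.comp continuous_snd)
  exact (h1.mul h2).congr fun p => ((WeakDual.toStrongDual p.2.1).map_smul _ _).symm

/-- Norm convergence of operators is uniform convergence of their pairings, which preserves
continuity. -/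
theorem continuous_ballPairing_of_hasSum {ι : Type*} {u : ι → X →L[𝕜] Y} {S : X →L[𝕜] Y}
    (hu : ∀ i, Continuous (ballPairing (u i))) (h : HasSum u S) : Continuous (ballPairing S) := by
  classical
  have hsum : ∀ s : Finset ι, Continuous (ballPairing (∑ i ∈ s, u i)) := by
    intro s
    induction s using Finset.induction_on with
    | empty =>
      have : ballPairing (0 : X →L[𝕜] Y) = fun _ => 0 := funext fun p => by simp [ballPairing]
      simpa [this] using continuous_const
    | insert i s hi ih =>
      rw [Finset.sum_insert hi]
      exact ((hu i).add ih).congr fun p => (ballPairing_add _ _ p).symm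
  have hunif : TendstoUniformly (fun s : Finset ι => ballPairing (∑ i ∈ s, u i)) (ballPairing S)
      Filter.atTop := by
    rw [Metric.tendstoUniformly_iff]
    intro ε hε
    filter_upwards [(Metric.tendsto_nhds.mp h) ε hε] with s hs p
    rw [dist_comm, dist_eq_norm, ← ballPairing_sub]
    exact (norm_ballPairing_le _ _).trans_lt (by rwa [← dist_eq_norm])
  exact hunif.continuous (Filter.Eventually.frequently (.of_forall hsum))

/-- A bounded sequence of operators with continuous pairings that tends to zero in the weak operator
topology has no functional bounded away from zero along it. -/
theorem exists_re_apply_lt (hX : IsReflexiveSpace 𝕜 X) {S : ℕ → X →L[𝕜] Y} {C : ℝ}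
    (hSC : ∀ n, ‖S n‖ ≤ C) (hcont : ∀ n, Continuous (ballPairing (S n)))
    (hlim : ∀ x, Filter.Tendsto (fun n => S n x) Filter.atTop (nhds 0))
    (φ : StrongDual 𝕜 (X →L[𝕜] Y)) {δ : ℝ} (hδ : 0 < δ) : ∃ n, RCLike.re (φ (S n)) < δ := by
  by_contra! h
  have : CompactSpace (WeakUnitBall 𝕜 X) :=
    isCompact_iff_compactSpace.mp (isCompact_closedBall_weakSpace hX 1)
  have : CompactSpace (WeakStarUnitBall 𝕜 Y) :=
    isCompact_iff_compactSpace.mp (WeakDual.isCompact_closedBall (0 : StrongDual 𝕜 Y) 1)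
  have : T2Space (WeakSpace 𝕜 X) :=
    (NormedSpace.isEmbedding_inclusionInDoubleDualWeak 𝕜 X).t2Space
  let f : ℕ → C(WeakUnitBall 𝕜 X × WeakStarUnitBall 𝕜 Y, ℝ) := fun n =>
    ⟨fun p => ‖ballPairing (S n) p‖, (hcont n).norm⟩
  have hε : 0 < δ / (‖φ‖ + 1) := by positivity
  obtain ⟨g, hg, hgε⟩ := exists_mem_convexHull_forall_lt (f := f) (M := C)
    (fun n p => norm_nonneg (ballPairing (S n) p)) (fun n p => (norm_ballPairing_le _ _).trans (hSC n))
    (fun p => squeeze_zero (fun n => norm_nonneg (ballPairing (S n) p))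
      (fun n => norm_apply_weakStarUnitBall_le _ _) (by
        simpa using (hlim ((toWeakSpace 𝕜 X).symm p.1.1)).norm)) hε
  -- `D` is convex by the triangle inequality and contains every `f n`, so the small `g` dominates
  -- the pairing of some `T` with `δ ≤ re (φ T)`, while `‖T‖` is too small for that.
  let D : Set C(WeakUnitBall 𝕜 X × WeakStarUnitBall 𝕜 Y, ℝ) :=
    {g | ∃ T : X →L[𝕜] Y, δ ≤ RCLike.re (φ T) ∧ ∀ p, ‖ballPairing T p‖ ≤ g p}
  have hD : Convex ℝ D := by
    rintro g ⟨T, hT, hTg⟩ g' ⟨T', hT', hTg'⟩ a b ha hb hab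
    refine ⟨(a : 𝕜) • T + (b : 𝕜) • T', ?_, fun p => ?_⟩
    · rw [map_add, map_smul, map_smul, map_add, smul_eq_mul, smul_eq_mul, RCLike.re_ofReal_mul,
        RCLike.re_ofReal_mul]
      nlinarith
    · rw [ballPairing_add, ballPairing_smul, ballPairing_smul]
      refine (norm_add_le _ _).trans ?_
      rw [norm_smul, norm_smul, RCLike.norm_of_nonneg ha, RCLike.norm_of_nonneg hb]
      exact add_le_add (mul_le_mul_of_nonneg_left (hTg p) ha)
        (mul_le_mul_of_nonneg_left (hTg' p) hb)
  obtain ⟨T, hT, hTg⟩ := convexHull_min (by rintro _ ⟨n, rfl⟩; exact ⟨S n, h n, fun p => le_rfl⟩)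
    hD hg
  have hTn := opNorm_le_of_norm_ballPairing_le hε.le fun p => (hTg p).trans (hgε p).le
  have h1 := (RCLike.re_le_norm (φ T)).trans (φ.le_opNorm T)
  have h2 : ‖φ‖ * ‖T‖ ≤ ‖φ‖ * (δ / (‖φ‖ + 1)) := by gcongr
  have h3 : ‖φ‖ * (δ / (‖φ‖ + 1)) < δ := by
    rw [mul_div_assoc', div_lt_iff₀ (by positivity)]
    nlinarith
  linarith

end

/-! ### Multiplication operators -/

section

variable {𝕜 X : Type*} [RCLike 𝕜] [NormedAddCommGroup X] [NormedSpace 𝕜 X]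

theorem not_finiteDimensional_zeroAtInfty : ¬ FiniteDimensional 𝕜 C₀(ℕ, 𝕜) := by
  intro h
  let e : ℕ → C₀(ℕ, 𝕜) := fun n =>
    { toFun := Pi.single n 1
      continuous_toFun := continuous_of_discreteTopology
      zero_at_infty' := by
        rw [Filter.cocompact_eq_cofinite]
        refine tendsto_const_nhds.congr' (Filter.eventually_cofinite.mpr
          ((Set.finite_singleton n).subset fun m hm => ?_))
        by_contra hmn
        exact hm (by simp [Set.mem_singleton_iff.not.mp hmn]) }
  let coe : C₀(ℕ, 𝕜) →ₗ[𝕜] (ℕ → 𝕜) :=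
    { toFun := fun l => l, map_add' := fun _ _ => rfl, map_smul' := fun _ _ => rfl }
  have hli : LinearIndependent 𝕜 e :=
    LinearIndependent.of_comp coe (Pi.linearIndependent_single_one ℕ 𝕜)
  have := hli.finite_of_isNoetherian
  exact not_finite ℕ

theorem IsStrictlySingular.isCZeroSingular {Y Z : Type*} [NormedAddCommGroup Y] [NormedSpace 𝕜 Y]
    [NormedAddCommGroup Z] [NormedSpace 𝕜 Z] {T : Y →L[𝕜] Z} (hT : IsStrictlySingular T) :
    IsCZeroSingular T := by
  rintro M ⟨e⟩
  exact hT M fun _ => not_finiteDimensional_zeroAtInfty (𝕜 := 𝕜)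
    e.toLinearEquiv.symm.finiteDimensional

theorem multiplicationOperator_smulRight (A B T : X →L[𝕜] X) (g : StrongDual 𝕜 X) (x : X) :
    multiplicationOperator A B ((g.smulRight x).comp T) =
      (g.comp (T.comp B)).smulRight (A x) := by
  ext y
  simp [multiplicationOperator_apply]

theorem hasSum_multiplicationOperator [CompleteSpace X] {β : Type*}
    (b : UnconditionalSchauderBasis β 𝕜 X) {A B : X →L[𝕜] X}
    (hV : IsCZeroSingular (multiplicationOperator A B)) (T : X →L[𝕜] X) :
    HasSum (fun i => multiplicationOperator A B (((b.coord i).smulRight (b i)).comp T))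
      (multiplicationOperator A B T) := by
  classical
  have hsum : Summable
      fun i => multiplicationOperator A B (((b.coord i).smulRight (b i)).comp T) := by
    by_contra hns
    obtain ⟨ε, hε, t, ht, htε⟩ := exists_disjoint_blocks_of_not_summable hns
    obtain ⟨C, hC⟩ := b.exists_norm_proj_le
    -- Sums of `P_{t n} T` over disjoint blocks are again `P_s T` for a finite `s`, hence bounded by
    -- `C * ‖T‖`.
    refine not_isCZeroSingular_of_norm_sum_le (u := fun n => (b.proj (t n)).comp T)
      (C := C * ‖T‖) (fun s => ?_) _ hε (fun n => ?_) hV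
    · have : ∑ n ∈ s, (b.proj (t n)).comp T = (b.proj (s.biUnion t)).comp T := by
        rw [GeneralSchauderBasis.proj, Finset.sum_biUnion fun m _ n _ hmn => ht hmn,
          ContinuousLinearMap.finsetSum_comp]
        rfl
      rw [this]
      exact (ContinuousLinearMap.opNorm_comp_le _ _).trans (by gcongr; exact hC _)
    · refine (htε n).trans_eq ?_
      rw [← map_sum, ← ContinuousLinearMap.finsetSum_comp]
      rfl
  obtain ⟨S, hS⟩ := hsum
  -- The norm sum is identified pointwise, by expanding `T (B x)` in the basis.
  convert hS
  ext x
  have h1 := hS.mapL (ContinuousLinearMap.apply 𝕜 X x)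
  have h2 := (b.expansion (T (B x))).mapL A
  refine h2.unique (h1.congr_fun ?_)
  intro i
  simp [multiplicationOperator_apply]

theorem isCompactOperator_smulRight (g : StrongDual 𝕜 X) (x : X) :
    IsCompactOperator (g.smulRight x) := by
  have : IsCompactOperator g :=
    (isCompactOperator_id : IsCompactOperator (id : 𝕜 → 𝕜)).comp_clm g
  exact this.clm_comp (ContinuousLinearMap.toSpanSingleton 𝕜 x)

theorem isCompactOperator_comp_of_isCZeroSingular [CompleteSpace X]
    (hX : HasUnconditionalBasis 𝕜 X) {A B : X →L[𝕜] X}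
    (hV : IsCZeroSingular (multiplicationOperator A B)) : IsCompactOperator (A.comp B) := by
  obtain ⟨β, -, ⟨b⟩⟩ := hX
  refine isCompactOperator_of_tendsto (hasSum_multiplicationOperator b hV (.id 𝕜 X))
    (.of_forall fun s => ?_)
  refine (compactOperator (RingHom.id 𝕜) X X).sum_mem fun i _ => ?_
  rw [multiplicationOperator_smulRight]
  exact isCompactOperator_smulRight _ _

/-- Otherwise counterexamples along finite sets exhausting `β` give a bounded sequence tending
strongly to zero after applying `L_A R_B`, with `φ` bounded away from zero, against
`exists_re_apply_lt`. -/
theorem exists_finset_norm_apply_sub_lt [CompleteSpace X] (hX : IsReflexiveSpace 𝕜 X)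
    {β : Type*} [Countable β] (b : UnconditionalSchauderBasis β 𝕜 X) {A B : X →L[𝕜] X}
    (hV : IsCZeroSingular (multiplicationOperator A B))
    (φ : StrongDual 𝕜 (X →L[𝕜] X)) {ε : ℝ} (hε : 0 < ε) :
    ∃ s : Finset β, ∀ T : X →L[𝕜] X, ‖T‖ ≤ 1 →
      ‖φ (multiplicationOperator A B (T - T.comp (b.proj s)))‖ < ε := by
  by_contra! h
  choose T hT hTε using h
  obtain ⟨s, hs⟩ := (Filter.atTop : Filter (Finset β)).exists_seq_tendsto
  choose c hc hcφ using fun n => RCLike.exists_norm_eq_mul_self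
    (φ (multiplicationOperator A B (T (s n) - (T (s n)).comp (b.proj (s n)))))
  obtain ⟨C, hC⟩ := b.exists_norm_proj_le
  -- The unimodular `c n` rotates the value of `φ` onto its norm.
  let U : ℕ → X →L[𝕜] X := fun n => c n • (T (s n) - (T (s n)).comp (b.proj (s n)))
  have hU : ∀ n x, ‖U n x‖ ≤ ‖x - b.proj (s n) x‖ := fun n x => by
    have : U n x = c n • T (s n) (x - b.proj (s n) x) := by
      simp [U]
    rw [this, norm_smul, hc, one_mul]
    exact ((T (s n)).le_opNorm _).trans (mul_le_of_le_one_left (norm_nonneg _) (hT _))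
  have hUC : ∀ n, ‖U n‖ ≤ 1 + C := fun n => by
    have hC0 : 0 ≤ C := (norm_nonneg _).trans (hC ∅)
    refine (U n).opNorm_le_bound (by positivity) fun x => (hU n x).trans ?_
    refine (norm_sub_le _ _).trans ?_
    rw [add_mul, one_mul]
    gcongr
    exact (b.proj (s n)).le_of_opNorm_le (hC _) x
  obtain ⟨n, hn⟩ := exists_re_apply_lt hX (S := fun n => multiplicationOperator A B (U n))
    (C := ‖multiplicationOperator A B‖ * (1 + C))
    (fun n => (multiplicationOperator A B).le_opNorm_of_le (hUC n))
    (fun n => continuous_ballPairing_of_hasSum (fun i => by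
      rw [multiplicationOperator_smulRight]
      exact continuous_ballPairing_smulRight _ _) (hasSum_multiplicationOperator b hV (U n)))
    (fun x => by
      have h0 : Filter.Tendsto (fun n => ‖A‖ * ‖B x - b.proj (s n) (B x)‖) Filter.atTop
          (nhds 0) := by
        have := ((tendsto_const_nhds (x := B x)).sub
          ((b.tendsto_proj (B x)).comp hs)).norm.const_mul ‖A‖
        simpa using this
      exact squeeze_zero_norm (fun n => (A.le_opNorm _).trans (by gcongr; exact hU n _)) h0)
    φ hε
  refine absurd (hTε (s n)) (not_le.mpr ?_)
  have : φ (multiplicationOperator A B (U n)) =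
      (‖φ (multiplicationOperator A B (T (s n) - (T (s n)).comp (b.proj (s n))))‖ : 𝕜) := by
    rw [hcφ, map_smul, map_smul, smul_eq_mul]
  simpa only [this, RCLike.ofReal_re] using hn

/-- The closed unit ball of `𝓛(X)` is compact in the topology of pointwise weak convergence. -/
theorem isCompact_unitBall_pointwise_weak (hX : IsReflexiveSpace 𝕜 X) :
    IsCompact ((fun (T : X →L[𝕜] X) (x : X) => toWeakSpace 𝕜 X (T x)) ''
      Metric.closedBall (0 : X →L[𝕜] X) 1) := by
  have : T2Space (WeakSpace 𝕜 X) :=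
    (NormedSpace.isEmbedding_inclusionInDoubleDualWeak 𝕜 X).t2Space
  -- Tychonoff for the balls of radius `‖x‖`, cut down by the closed conditions of linearity.
  have hcomp := ((isCompact_univ_pi fun x : X => isCompact_closedBall_weakSpace hX ‖x‖).inter_right
    (isClosed_setOfPred_map_add (M₁ := X) (M₂ := WeakSpace 𝕜 X))).inter_right
    (isClosed_setOfPred_map_smul (M := 𝕜) X (WeakSpace 𝕜 X) id)
  convert hcomp
  ext f
  constructor
  · rintro ⟨T, hT, rfl⟩
    refine ⟨⟨fun x _ => ⟨T x, ?_, rfl⟩, fun x y => by simp⟩, fun c x => by simp⟩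
    rw [mem_closedBall_zero_iff] at hT ⊢
    exact (T.le_opNorm x).trans (mul_le_of_le_one_left (norm_nonneg _) hT)
  · rintro ⟨⟨hb, hadd⟩, hsmul⟩
    let T₀ : X →ₗ[𝕜] X :=
      { toFun := fun x => (toWeakSpace 𝕜 X).symm (f x)
        map_add' := fun x y => by rw [hadd x y, map_add]
        map_smul' := fun c x => by rw [hsmul c x, map_smul]; rfl }
    have hT₀ : ∀ x, ‖T₀ x‖ ≤ 1 * ‖x‖ := fun x => by
      obtain ⟨y, hy, hyx⟩ := hb x trivial
      have : T₀ x = y := by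
        simp only [T₀, LinearMap.coe_mk, AddHom.coe_mk, ← hyx, LinearEquiv.symm_apply_apply]
      rw [this, one_mul]
      exact mem_closedBall_zero_iff.mp hy
    refine ⟨T₀.mkContinuous 1 hT₀, mem_closedBall_zero_iff.mpr
      (T₀.mkContinuous_norm_le zero_le_one hT₀), ?_⟩
    ext x
    exact (toWeakSpace 𝕜 X).apply_symm_apply (f x)

theorem isWeaklyCompactOperator_of_isCZeroSingular [CompleteSpace X]
    (hX : IsReflexiveSpace 𝕜 X) (hb : HasUnconditionalBasis 𝕜 X) {A B : X →L[𝕜] X}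
    (hV : IsCZeroSingular (multiplicationOperator A B)) :
    IsWeaklyCompactOperator (multiplicationOperator A B) := by
  obtain ⟨β, _, ⟨b⟩⟩ := hb
  let ev : (X →L[𝕜] X) → X → WeakSpace 𝕜 X := fun T x => toWeakSpace 𝕜 X (T x)
  let I : Set (X → WeakSpace 𝕜 X) := ev '' Metric.closedBall 0 1
  have hI : CompactSpace I := isCompact_iff_compactSpace.mp (isCompact_unitBall_pointwise_weak hX)
  choose op hop hopev using fun f : I => f.2
  have hev : Function.Injective ev := fun T T' h => by
    ext x
    exact (toWeakSpace 𝕜 X).injective (congrFun h x)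
  let Ψ : I → WeakSpace 𝕜 (X →L[𝕜] X) := fun f =>
    toWeakSpace 𝕜 (X →L[𝕜] X) (multiplicationOperator A B (op f))
  have hΨ : Continuous Ψ := by
    -- Each `φ ∘ V` is a uniform limit on the ball of functions of finitely many values `T b_i`.
    refine continuous_to_weakSpace fun φ => continuous_of_uniform_approx_of_continuous fun u hu => ?_
    obtain ⟨ε, hε, hεu⟩ := Metric.mem_uniformity_dist.mp hu
    obtain ⟨s, hs⟩ := exists_finset_norm_apply_sub_lt hX b hV φ hε
    refine ⟨fun f => φ (multiplicationOperator A B ((op f).comp (b.proj s))), ?_, fun f => hεu ?_⟩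
    · have hterm : ∀ f : I, φ (multiplicationOperator A B ((op f).comp (b.proj s))) =
          ∑ i ∈ s, (φ.comp ((multiplicationOperator A B).comp
            (ContinuousLinearMap.smulRightL 𝕜 X X (b.coord i))))
            ((toWeakSpace 𝕜 X).symm (f.1 (b i))) := by
        intro f
        rw [← hopev f]
        simp only [ev, LinearEquiv.symm_apply_apply, ContinuousLinearMap.comp_apply, ← map_sum]
        congr 2
        ext x
        simp
      simp_rw [hterm]
      exact continuous_finsetSum _ fun i _ => (continuous_weakSpace_apply _).comp
        ((continuous_apply (b i)).comp continuous_subtype_val)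
    · have := hs (op f) (mem_closedBall_zero_iff.mp (hop f))
      rw [map_sub, map_sub] at this
      rw [dist_eq_norm]
      exact this
  have hrange : toWeakSpace 𝕜 (X →L[𝕜] X) '' (multiplicationOperator A B ''
      Metric.closedBall (0 : X →L[𝕜] X) 1) = Set.range Ψ := by
    ext z
    constructor
    · rintro ⟨_, ⟨T, hT, rfl⟩, rfl⟩
      refine ⟨⟨ev T, T, hT, rfl⟩, ?_⟩
      simp only [Ψ, hev (hopev ⟨ev T, T, hT, rfl⟩)]
    · rintro ⟨f, rfl⟩
      exact ⟨_, ⟨op f, hop f, rfl⟩, rfl⟩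
  rw [IsWeaklyCompactOperator, hrange]
  exact (isCompact_range hΨ).closure

end

theorem corollary4p2 {𝕜 X : Type*} [RCLike 𝕜] [NormedAddCommGroup X] [NormedSpace 𝕜 X]
    [CompleteSpace X] (A B : X →L[𝕜] X) :
    (IsStrictlySingular (multiplicationOperator A B) →
      IsCZeroSingular (multiplicationOperator A B)) ∧
    (IsReflexiveSpace 𝕜 X → HasUnconditionalBasis 𝕜 X →
      (IsCZeroSingular (multiplicationOperator A B) → IsCompactOperator (A.comp B)) ∧
      (IsCZeroSingular (multiplicationOperator A B) →
        IsWeaklyCompactOperator (multiplicationOperator A B)) ∧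
      (IsStrictlySingular (multiplicationOperator A B) →
        IsWeaklyCompactOperator (multiplicationOperator A B))) :=
  ⟨fun h => h.isCZeroSingular, fun hX hb =>
    ⟨fun h => isCompactOperator_comp_of_isCZeroSingular hb h,
      fun h => isWeaklyCompactOperator_of_isCZeroSingular hX hb h,
      fun h => isWeaklyCompactOperator_of_isCZeroSingular hX hb h.isCZeroSingular⟩⟩
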